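/- Let $X$ be a set of positive integers and $X^*=X\setminus\{1\}$. Let $\mathcal G(X)$ be the simplicial complex with vertex set $X^*$ whose simplices are the nonempty finite sets $\sigma\subseteq X^*$ with $\gcd(\sigma)>1$. Let $\mathcal D(X)$ be the simplicial complex whose vertices are the primes dividing at least one member of $X$ and whose simplices are the nonempty finite sets of such primes all of which divide one common member of $X$. For a simplex $\sigma$ of $\mathcal G(X)$ let $\eta(\sigma)$ be the simplex of $\mathcal D(X)$ whose vertices are the primes dividing $\gcd(\sigma)$. An edge-path in a complex is a sequence of vertices $v_1,\dots,v_n$ ($n\ge 1$), written $\langle v_1,v_2\rangle\cdots\langle v_{n-1},v_n\rangle$, such that each $\{v_i,v_{i+1}\}$ is a simplex (possibly $v_i=v_{i+1}$). Two edge-paths are homotopic if they are related by finitely many simple equivalences: replacing $\langle v_1,v_3\rangle\langle v_3,v_2\rangle$ by $\langle v_1,v_2\rangle$ or conversely when $v_1,v_2,v_3$ (not necessarily distinct) lie in a common simplex, and deleting or inserting a repeated vertex $\langle v,v\rangle$. Homotopy classes of edge-loops at a vertex form a group under concatenation, the edge-path group at that vertex; an edge-loop also determines an element of the topological fundamental group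 of the geometric realization at that vertex. For an edge-path $L=\langle v_1,v_2\rangle\cdots\langle v_{n-1},v_n\rangle$ in $\mathcal G(X)$, a path $\eta_*(L)$ is any edge-path $\langle\omega_1,\omega_2\rangle\cdots\langle\omega_{n-1},\omega_n\rangle$ in $\mathcal D(X)$ with $\omega_i\in\eta(\{v_i,v_{i+1}\})$ for $i<n$ and $\omega_n\in\eta(\{v_n\})$. Suppose that $\mathcal G(X)$ is connected. Let $v$ be a vertex of $\mathcal G(X)$ and $p$ a prime dividing $v$. Then there is exactly one map $$\eta_*:\pi_1(\mathcal G(X),v)\to\pi_1(\mathcal D(X),p)$$ which, for every edge-loop $L$ at $v$ and every choice $\langle\omega_1,\omega_2\rangle\cdots\langle\omega_{n-1},\omega_n\rangle$ of $\eta_*(L)$, sends the class of $L$ to the class of the loop $\langle p,\omega_1\rangle\langle\omega_1,\omega_2\rangle\cdots\langle\omega_{n-1},\omega_n\rangle\langle\omega_n,p\rangle$; and this map is a group isomorphism. This holds both when $\pi_1$ denotes the edge-path group and when it denotes the topological fundamental group of the geometric realization (with its usual weak topology, which is the Euclidean one when there are finitely many vertices). In particular, it holds for $X=\mathrm{cd}(G)$,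 the set of degrees of the irreducible complex characters of a finite group $G$, whenever $\mathcal G(\mathrm{cd}(G))$ is connected. -/

import Mathlib

namespace DivisorComplex

/-! ## Edge-paths and the edge-path group of a simplicial complex -/

section EdgePaths

variable {V : Type*} [DecidableEq V]

/-- Edge-paths `⟨v₁,v₂⟩⟨v₂,v₃⟩⋯⟨vₙ₋₁,vₙ⟩` in a simplicial complex: consecutive vertices span a
simplex.  Degenerate edges `⟨v,v⟩` are allowed, and `nil v` is the path with the single
vertex `v`. -/
inductive EdgePath (K : AbstractSimplicialComplex V) : V → V → Type _
  | nil (v : V) : EdgePath K v v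
  | cons {u v w : V} (h : ({u, v} : Finset V) ∈ K) (P : EdgePath K v w) : EdgePath K u w

namespace EdgePath

variable {K : AbstractSimplicialComplex V}

/-- The edge-path `⟨u,v⟩`. -/
def edge {u v : V} (h : ({u, v} : Finset V) ∈ K) : EdgePath K u v := cons h (nil v)

/-- Concatenation of edge-paths. -/
def append : {u v w : V} → EdgePath K u v → EdgePath K v w → EdgePath K u w
  | _, _, _, nil _, Q => Q
  | _, _, _, cons h P, Q => cons h (append P Q)

/-- The edge-path run backwards. -/
def reverse : {u v : V} → EdgePath K u v → EdgePath K v u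
  | _, _, nil v => nil v
  | _, _, cons h P => append (reverse P) (edge (by rwa [Finset.pair_comm] at h))

theorem append_nil {u v : V} (P : EdgePath K u v) : P.append (nil v) = P := by
  induction P with
  | nil v => rfl
  | cons h P ih => simp only [append, ih]

theorem append_assoc {u v w x : V} (P : EdgePath K u v) (Q : EdgePath K v w)
    (R : EdgePath K w x) : (P.append Q).append R = P.append (Q.append R) := by
  induction P with
  | nil v => rfl
  | cons h P ih => simp only [append, ih]

theorem reverse_append {u v w : V} (P : EdgePath K u v) (Q : EdgePath K v w) :
    (P.append Q).reverse = Q.reverse.append P.reverse := by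
  induction P with
  | nil v => simp only [append, reverse, append_nil]
  | cons h P ih => simp only [append, reverse, ih, append_assoc]

/-- One simple equivalence of edge-paths (read from left to right): two consecutive edges
`⟨v₁,v₃⟩⟨v₃,v₂⟩` are replaced by `⟨v₁,v₂⟩` when some simplex contains `v₁`, `v₂`, `v₃` (not
necessarily distinct), or a repeated vertex is removed. -/
inductive SimpleEquiv : {u w : V} → EdgePath K u w → EdgePath K u w → Prop
  | triangle {u v₁ v₂ v₃ w : V} (P : EdgePath K u v₁) (Q : EdgePath K v₂ w)
      (h₁₃ : ({v₁, v₃} : Finset V) ∈ K) (h₃₂ : ({v₃, v₂} : Finset V) ∈ K)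
      (h₁₂ : ({v₁, v₂} : Finset V) ∈ K) (h : ({v₁, v₂, v₃} : Finset V) ∈ K) :
      SimpleEquiv (P.append (cons h₁₃ (cons h₃₂ Q))) (P.append (cons h₁₂ Q))
  | repeated {u v w : V} (P : EdgePath K u v) (Q : EdgePath K v w)
      (h : ({v, v} : Finset V) ∈ K) :
      SimpleEquiv (P.append (cons h Q)) (P.append Q)

/-- Two edge-paths are homotopic if one is obtained from the other by finitely many simple
equivalences (in either direction). -/
def Homotopic {u w : V} (P Q : EdgePath K u w) : Prop := Relation.EqvGen SimpleEquiv P Q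

theorem Homotopic.map {u w u' w' : V} (f : EdgePath K u w → EdgePath K u' w')
    (hf : ∀ P Q, SimpleEquiv P Q → Homotopic (f P) (f Q)) {P Q : EdgePath K u w}
    (h : Homotopic P Q) : Homotopic (f P) (f Q) := by
  induction h with
  | rel P Q h => exact hf P Q h
  | refl P => exact .refl _
  | symm P Q _ ih => exact .symm _ _ ih
  | trans P Q R _ _ ih₁ ih₂ => exact .trans _ _ _ ih₁ ih₂

theorem SimpleEquiv.append_left {u v w : V} (R : EdgePath K u v) {P Q : EdgePath K v w}
    (h : SimpleEquiv P Q) : SimpleEquiv (R.append P) (R.append Q) := by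
  cases h with
  | triangle A B h₁ h₂ h₃ h =>
    simpa only [append_assoc] using SimpleEquiv.triangle (R.append A) B h₁ h₂ h₃ h
  | repeated A B h => simpa only [append_assoc] using SimpleEquiv.repeated (R.append A) B h

theorem SimpleEquiv.append_right {u v w : V} {P Q : EdgePath K u v} (h : SimpleEquiv P Q)
    (R : EdgePath K v w) : SimpleEquiv (P.append R) (Q.append R) := by
  cases h with
  | triangle A B h₁ h₂ h₃ h =>
    simpa only [append_assoc, append] using SimpleEquiv.triangle A (B.append R) h₁ h₂ h₃ h
  | repeated A B h =>
    simpa only [append_assoc, append] using SimpleEquiv.repeated A (B.append R) h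

theorem SimpleEquiv.reverse {u v : V} {P Q : EdgePath K u v} (h : SimpleEquiv P Q) :
    SimpleEquiv P.reverse Q.reverse := by
  cases h with
  | triangle A B h₁ h₂ h₃ h =>
    simp only [reverse_append, EdgePath.reverse, append_assoc, edge, append]
    refine SimpleEquiv.triangle _ _ _ _ _ ?_
    rwa [Finset.insert_comm]
  | repeated A B h =>
    simp only [reverse_append, EdgePath.reverse, append_assoc, edge, append]
    exact SimpleEquiv.repeated _ _ _

theorem Homotopic.append {u v w : V} {P P' : EdgePath K u v} {Q Q' : EdgePath K v w}
    (hP : Homotopic P P') (hQ : Homotopic Q Q') :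
    Homotopic (P.append Q) (P'.append Q') :=
  .trans _ _ _ (hP.map (fun X => X.append Q) fun _ _ h => .rel _ _ (h.append_right Q))
    (hQ.map (fun X => P'.append X) fun _ _ h => .rel _ _ (h.append_left P'))

theorem Homotopic.reverse {u v : V} {P Q : EdgePath K u v} (h : Homotopic P Q) :
    Homotopic P.reverse Q.reverse :=
  h.map EdgePath.reverse fun _ _ h => .rel _ _ h.reverse

theorem reverse_append_self {u v : V} (P : EdgePath K u v) :
    Homotopic (P.reverse.append P) (nil v) := by
  induction P with
  | nil v => exact .refl _
  | @cons u v w h P ih =>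
    simp only [EdgePath.reverse, append_assoc, edge, EdgePath.append]
    have hvv : ({v, v} : Finset V) ∈ K := by
      rw [Finset.pair_eq_singleton]; exact K.singleton_mem v
    refine .trans _ _ _ (.rel _ _ (SimpleEquiv.triangle P.reverse P _ _ hvv ?_)) ?_
    · rw [Finset.pair_comm] at h
      simpa using h
    · exact .trans _ _ _ (.rel _ _ (SimpleEquiv.repeated P.reverse P hvv)) ih

/-- Homotopy of edge-loops at a given base vertex, as an equivalence relation. -/
def homotopicSetoid (K : AbstractSimplicialComplex V) (v : V) : Setoid (EdgePath K v v) :=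
  ⟨Homotopic, Relation.EqvGen.is_equivalence _⟩

end EdgePath

/-- The fundamental group of `K` at the vertex `v` in its edge-path form: homotopy classes of
edge-loops at `v`, multiplied by concatenation. -/
def EdgePathGroup (K : AbstractSimplicialComplex V) (v : V) : Type _ :=
  Quotient (EdgePath.homotopicSetoid K v)

namespace EdgePathGroup

variable {K : AbstractSimplicialComplex V} {v : V}

/-- The class of an edge-loop. -/
def mk (L : EdgePath K v v) : EdgePathGroup K v := Quotient.mk _ L

instance : Group (EdgePathGroup K v) where
  mul := Quotient.map₂ EdgePath.append fun _ _ h₁ _ _ h₂ => EdgePath.Homotopic.append h₁ h₂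
  one := mk (EdgePath.nil v)
  inv := Quotient.map EdgePath.reverse fun _ _ h => EdgePath.Homotopic.reverse h
  mul_assoc := by
    rintro ⟨P⟩ ⟨Q⟩ ⟨R⟩
    exact congrArg mk (EdgePath.append_assoc P Q R)
  one_mul := by
    rintro ⟨P⟩
    rfl
  mul_one := by
    rintro ⟨P⟩
    exact congrArg mk (EdgePath.append_nil P)
  inv_mul_cancel := by
    rintro ⟨P⟩
    exact Quotient.sound (EdgePath.reverse_append_self P)

end EdgePathGroup

/-- A simplicial complex is connected if any two vertices are joined by an edge-path. -/
def IsConnected (K : AbstractSimplicialComplex V) : Prop :=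
  ∀ u v : V, Nonempty (EdgePath K u v)

end EdgePaths

/-! ## The geometric realization and its topological fundamental group -/

section Realization

variable {V : Type*}

/-- The closed geometric simplex spanned by `s`, in barycentric coordinates (so every vertex
sits at 1 on its own axis). -/
def closedSimplex (s : Finset V) : Set (V → ℝ) :=
  {x | (∀ v, 0 ≤ x v) ∧ (∀ v, v ∉ s → x v = 0) ∧ ∑ v ∈ s, x v = 1}

/-- The points of the geometric realization `|K|`: the union of the closed simplices of `K`. -/
@[ext]
structure Realization (K : AbstractSimplicialComplex V) where
  coord : V → ℝ
  mem_simplex : ∃ s ∈ K, coord ∈ closedSimplex s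

namespace Realization

variable {K : AbstractSimplicialComplex V}

/-- The inclusion of a closed simplex of `K`. -/
def ofSimplex (s : {s : Finset V // s ∈ K}) (x : closedSimplex s.1) : Realization K :=
  ⟨x.1, s.1, s.2, x.2⟩

/-- The usual (weak) topology of `|K|`: a set is open iff it meets every closed simplex in an
open subset of that simplex, which has its Euclidean topology.  For finitely many vertices it is
the subspace topology of Euclidean space. -/
instance : TopologicalSpace (Realization K) :=
  ⨆ s : {s : Finset V // s ∈ K}, TopologicalSpace.coinduced (ofSimplex s) inferInstance

theorem continuous_ofSimplex (s : {s : Finset V // s ∈ K}) :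
    Continuous (ofSimplex s) :=
  continuous_iSup_rng (i := s) continuous_coinduced_rng

variable [DecidableEq V]

theorem single_mem (v : V) : (Pi.single v 1 : V → ℝ) ∈ closedSimplex {v} := by
  refine ⟨fun w => ?_, fun w hw => ?_, by simp⟩
  · by_cases h : w = v
    · subst h; simp
    · simp [h]
  · simp only [Finset.mem_singleton] at hw
    simp [hw]

/-- A vertex of `K` as a point of `|K|`. -/
def vertex (K : AbstractSimplicialComplex V) (v : V) : Realization K :=
  ⟨Pi.single v 1, {v}, K.singleton_mem v, single_mem v⟩

theorem segment_mem (u v : V) (t : unitInterval) :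
    (fun w => (1 - (t : ℝ)) * (Pi.single u 1 : V → ℝ) w + t * (Pi.single v 1 : V → ℝ) w) ∈
      closedSimplex {u, v} := by
  have h0 := t.2.1
  have h1 := t.2.2
  have hs : ∀ a b : V, (0 : ℝ) ≤ (Pi.single a 1 : V → ℝ) b := fun a b => (single_mem a).1 b
  refine ⟨fun w => ?_, fun w hw => ?_, ?_⟩
  · exact add_nonneg (mul_nonneg (by linarith) (hs u w)) (mul_nonneg h0 (hs v w))
  · simp only [Finset.mem_insert, Finset.mem_singleton, not_or] at hw
    simp [hw.1, hw.2]
  · rw [Finset.sum_add_distrib, ← Finset.mul_sum, ← Finset.mul_sum]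
    simp

/-- The straight path in `|K|` along an edge `⟨u,v⟩`. -/
def edgePath {u v : V} (h : ({u, v} : Finset V) ∈ K) : Path (vertex K u) (vertex K v) where
  toFun t := ofSimplex ⟨{u, v}, h⟩ ⟨_, segment_mem u v t⟩
  continuous_toFun := by
    refine (continuous_ofSimplex _).comp (Continuous.subtype_mk ?_ _)
    exact continuous_pi fun w => by fun_prop
  source' := by
    ext w
    simp [ofSimplex, vertex]
  target' := by
    ext w
    simp [ofSimplex, vertex]

end Realization

/-- The path in `|K|` traced out by an edge-path. -/
noncomputable def EdgePath.toPath [DecidableEq V] {K : AbstractSimplicialComplex V} :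
    {u v : V} → EdgePath K u v → Path (Realization.vertex K u) (Realization.vertex K v)
  | _, _, .nil v => Path.refl (Realization.vertex K v)
  | _, _, .cons h P => (Realization.edgePath h).trans (EdgePath.toPath P)

/-- The class in `π₁(|K|, v)` of an edge-loop at `v`. -/
noncomputable def EdgePath.toFundamentalGroup [DecidableEq V] {K : AbstractSimplicialComplex V}
    {v : V} (L : EdgePath K v v) : FundamentalGroup (Realization K) (Realization.vertex K v) :=
  FundamentalGroup.fromPath (Path.Homotopic.Quotient.mk L.toPath)

end Realization

/-! ## The two complexes of a set of positive integers -/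

/-- The elements of `X* = X \ {1}`. -/
abbrev GVertex (X : Set ℕ+) : Type := {n : ℕ+ // n ∈ X \ {1}}

/-- The primes dividing at least one member of `X`. -/
abbrev DVertex (X : Set ℕ+) : Type := {p : ℕ // p.Prime ∧ ∃ n ∈ X, p ∣ (n : ℕ)}

/-- The greatest common divisor of a finite set of members of `X*`. -/
def setGcd {X : Set ℕ+} (s : Finset (GVertex X)) : ℕ := s.gcd fun v => ((v : ℕ+) : ℕ)

/-- The common divisor simplicial complex `𝒢(X)`. -/
def commonDivisorComplex (X : Set ℕ+) : AbstractSimplicialComplex (GVertex X) where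
  faces := {s | s.Nonempty ∧ 1 < setGcd s}
  isRelLowerSet_faces := by
    rintro s ⟨hs, h⟩
    refine ⟨hs, fun t hts ht => ⟨ht, lt_of_lt_of_le h (Nat.le_of_dvd ?_ (Finset.gcd_mono hts))⟩⟩
    obtain ⟨v, hv⟩ := ht
    exact Nat.pos_of_dvd_of_pos (Finset.gcd_dvd hv) v.1.pos
  singleton_mem v := by
    refine ⟨Finset.singleton_nonempty v, ?_⟩
    have h1 : v.1 ≠ 1 := v.2.2
    have : 1 < v.1 := lt_of_le_of_ne one_le (Ne.symm h1)
    have h2 : (1 : ℕ) < ((v.1 : ℕ+) : ℕ) := by exact_mod_cast this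
    simpa [setGcd] using h2

/-- The prime divisor simplicial complex `𝒟(X)`. -/
def primeDivisorComplex (X : Set ℕ+) : AbstractSimplicialComplex (DVertex X) where
  faces := {s | s.Nonempty ∧ ∃ n ∈ X, ∀ p ∈ s, (p : ℕ) ∣ (n : ℕ)}
  isRelLowerSet_faces := by
    rintro s ⟨hs, n, hn, h⟩
    exact ⟨hs, fun t hts ht => ⟨ht, n, hn, fun p hp => h p (hts hp)⟩⟩
  singleton_mem p := by
    obtain ⟨n, hn, h⟩ := p.2.2
    exact ⟨Finset.singleton_nonempty p, n, hn, by simpa using h⟩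

/-! ## The map `η` and the map it induces on edge-paths -/

open Classical in
/-- The map `η` from simplices of `𝒢(X)` to simplices of `𝒟(X)`: `η(σ)` has as vertices the
prime divisors of `gcd(σ)`. -/
noncomputable def eta {X : Set ℕ+} (σ : {s // s ∈ commonDivisorComplex X}) :
    {t // t ∈ primeDivisorComplex X} :=
  ⟨(setGcd σ.1).primeFactors.subtype _, by
    obtain ⟨σ, ⟨v, hv⟩, h⟩ := σ
    have hdvd : ∀ p ∈ (setGcd σ).primeFactors, p ∣ ((v : ℕ+) : ℕ) := fun p hp =>
      (Nat.dvd_of_mem_primeFactors hp).trans (Finset.gcd_dvd hv)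
    refine ⟨?_, v.1, v.2.1, fun p hp => hdvd _ (Finset.mem_subtype.1 hp)⟩
    obtain ⟨p, hp⟩ := Nat.nonempty_primeFactors.2 h
    exact ⟨⟨p, Nat.prime_of_mem_primeFactors hp, v.1, v.2.1, hdvd p hp⟩,
      Finset.mem_subtype.2 hp⟩⟩

/-- `EtaImage L M` says that `M` is one of the edge-paths `η_*(L)`: if
`L = ⟨v₁,v₂⟩⋯⟨vₙ₋₁,vₙ⟩`, then `M = ⟨ω₁,ω₂⟩⋯⟨ωₙ₋₁,ωₙ⟩` for some choice of
`ωᵢ ∈ η(⟨vᵢ,vᵢ₊₁⟩)` for `i < n` and `ωₙ ∈ η(vₙ)`. -/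
inductive EtaImage {X : Set ℕ+} : {u w : GVertex X} → {p r : DVertex X} →
    EdgePath (commonDivisorComplex X) u w → EdgePath (primeDivisorComplex X) p r → Prop
  | nil {v : GVertex X} {p : DVertex X}
      (hp : p ∈ (eta ⟨{v}, (commonDivisorComplex X).singleton_mem v⟩).1) :
      EtaImage (EdgePath.nil v) (EdgePath.nil p)
  | cons {u v w : GVertex X} {p q r : DVertex X} {L : EdgePath (commonDivisorComplex X) v w}
      {M : EdgePath (primeDivisorComplex X) q r}
      (h : ({u, v} : Finset (GVertex X)) ∈ commonDivisorComplex X) (hp : p ∈ (eta ⟨{u, v}, h⟩).1)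
      (hpq : ({p, q} : Finset (DVertex X)) ∈ primeDivisorComplex X) (hLM : EtaImage L M) :
      EtaImage (EdgePath.cons h L) (EdgePath.cons hpq M)

/-- `f` is the map `η_*` on edge-path groups, for base vertices `v` of `𝒢(X)` and `p ∣ v` of
`𝒟(X)`: it sends the class of any edge-loop `L` at `v` to the class of any choice
`M = ⟨ω₁,ω₂⟩⋯⟨ωₙ₋₁,ωₙ⟩` of `η_*(L)`, closed up to a loop at `p` as `⟨p,ω₁⟩ M ⟨ωₙ,p⟩`. -/
def IsEtaStar {X : Set ℕ+} {v : GVertex X} {p : DVertex X}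
    (f : EdgePathGroup (commonDivisorComplex X) v → EdgePathGroup (primeDivisorComplex X) p) :
    Prop :=
  ∀ (L : EdgePath (commonDivisorComplex X) v v) (q r : DVertex X)
    (M : EdgePath (primeDivisorComplex X) q r)
    (hq : ({p, q} : Finset (DVertex X)) ∈ primeDivisorComplex X)
    (hr : ({r, p} : Finset (DVertex X)) ∈ primeDivisorComplex X),
    EtaImage L M →
      f (EdgePathGroup.mk L) =
        EdgePathGroup.mk ((EdgePath.edge hq).append (M.append (EdgePath.edge hr)))

/-- The same for the topological fundamental groups of the geometric realizations. -/
def IsTopEtaStar {X : Set ℕ+} {v : GVertex X} {p : DVertex X}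
    (f : FundamentalGroup (Realization (commonDivisorComplex X)) (Realization.vertex _ v) →
      FundamentalGroup (Realization (primeDivisorComplex X)) (Realization.vertex _ p)) :
    Prop :=
  ∀ (L : EdgePath (commonDivisorComplex X) v v) (q r : DVertex X)
    (M : EdgePath (primeDivisorComplex X) q r)
    (hq : ({p, q} : Finset (DVertex X)) ∈ primeDivisorComplex X)
    (hr : ({r, p} : Finset (DVertex X)) ∈ primeDivisorComplex X),
    EtaImage L M →
      f L.toFundamentalGroup =
        ((EdgePath.edge hq).append (M.append (EdgePath.edge hr))).toFundamentalGroup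

/-- `η_*` is well defined on fundamental groups and is a group isomorphism, for all base vertices
`v` of `𝒢(X)` and `p ∈ η(v)` of `𝒟(X)`, both on edge-path groups and on the topological
fundamental groups of the geometric realizations: exactly one map has the defining property of
`η_*`, and it is a group isomorphism. -/
def EtaStarIsIsomorphism (X : Set ℕ+) : Prop :=
  ∀ (v : GVertex X) (p : DVertex X),
    p ∈ (eta ⟨{v}, (commonDivisorComplex X).singleton_mem v⟩).1 →
    (∃ Ψ : EdgePathGroup (commonDivisorComplex X) v ≃* EdgePathGroup (primeDivisorComplex X) p,
      IsEtaStar Ψ ∧ ∀ f, IsEtaStar f → f = Ψ) ∧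
    (∃ Φ : FundamentalGroup (Realization (commonDivisorComplex X)) (Realization.vertex _ v) ≃*
        FundamentalGroup (Realization (primeDivisorComplex X)) (Realization.vertex _ p),
      IsTopEtaStar Φ ∧ ∀ f, IsTopEtaStar f → f = Φ)

/-- The set `cd(G)` of the degrees of the irreducible complex characters of `G`. -/
def characterDegrees (G : Type*) [Group G] : Set ℕ+ :=
  {n | ∃ ρ : Representation ℂ G (Fin n → ℂ), ρ.IsIrreducible}

end DivisorComplex

namespace DivisorComplex

/-! ## Edge-paths in the two complexes of a relation -/

namespace EdgePath

variable {V : Type*} [DecidableEq V] {K : AbstractSimplicialComplex V}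

/-! Both complexes come from one relation, "the prime p divides n", in the manner of Dowker: members
of X* have gcd > 1 exactly when some prime divides them all. For any relation, an edge-path in one
complex is carried to the other by choosing, for each edge, an element related to both its ends.
Choices related to a common vertex span a simplex, so up to homotopy they do not matter
(`transport_cons`). Hence transport respects simple equivalences (`transport_homotopic`) and
concatenation (`transport_append`), and transporting back undoes it (`transport_transport`). A
closed-up η_*(L) is homotopic to the transport of L (`EtaImage.homotopic`), which settles the
edge-path groups.

For the realizations, the edge-path group of a connected complex has to be identified with the
topological one, up to the order of multiplication. Surjectivity: a path is subdivided into pieces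
lying in open stars, which are contractible (`exists_pathClass_eq`). Injectivity
(`homotopic_of_pathClass_eq`): instead of approximating homotopies simplicially, a covering of |K|
is built whose discrete fibre is the edge-path group. Its monodromy along an edge-path is
multiplication by the holonomy of that path (`monodromy_pathClass`). Monodromy depends only on the
topological homotopy class, while holonomy determines an edge-path up to simple equivalences. -/

theorem pair_self_mem (K : AbstractSimplicialComplex V) (v : V) : ({v, v} : Finset V) ∈ K := by
  rw [Finset.pair_eq_singleton]
  exact K.singleton_mem v

theorem Homotopic.refl {u v : V} (P : EdgePath K u v) : Homotopic P P :=
  Relation.EqvGen.refl P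

theorem Homotopic.symm {u v : V} {P Q : EdgePath K u v} (h : Homotopic P Q) : Homotopic Q P :=
  Relation.EqvGen.symm _ _ h

theorem Homotopic.trans {u v : V} {P Q R : EdgePath K u v} (h : Homotopic P Q)
    (h' : Homotopic Q R) : Homotopic P R :=
  Relation.EqvGen.trans _ _ _ h h'

theorem Homotopic.cons {u v w : V} (h : ({u, v} : Finset V) ∈ K) {P Q : EdgePath K v w}
    (hPQ : Homotopic P Q) : Homotopic (cons h P) (cons h Q) :=
  Homotopic.append (.refl (edge h)) hPQ

theorem Homotopic.triangle {u v w x : V} (h₁ : ({u, v} : Finset V) ∈ K)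
    (h₂ : ({v, w} : Finset V) ∈ K) (h₃ : ({u, w} : Finset V) ∈ K)
    (h : ({u, w, v} : Finset V) ∈ K) (P : EdgePath K w x) :
    Homotopic (EdgePath.cons h₁ (EdgePath.cons h₂ P)) (EdgePath.cons h₃ P) :=
  .rel _ _ (.triangle (nil u) P h₁ h₂ h₃ h)

theorem Homotopic.repeated {v w : V} (h : ({v, v} : Finset V) ∈ K) (P : EdgePath K v w) :
    Homotopic (EdgePath.cons h P) P :=
  .rel _ _ (.repeated (nil v) P h)

theorem append_reverse_self {u v : V} (P : EdgePath K u v) :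
    Homotopic (P.append P.reverse) (nil u) := by
  induction P with
  | nil v => exact .refl _
  | @cons u v w h P ih =>
    simp only [EdgePath.append, EdgePath.reverse, ← append_assoc]
    refine Homotopic.trans (.cons h (ih.append (.refl _))) ?_
    exact Homotopic.trans (.triangle _ _ (pair_self_mem K u) (by simpa using h) _) (.repeated _ _)

end EdgePath

open EdgePath

/-- `K` and `K'` are the two complexes of the relation `R`: a simplex is a nonempty finite set
of elements which are all related to a common one. -/
structure RelationComplexes {A B : Type*} (R : A → B → Prop) (K : AbstractSimplicialComplex A)
    (K' : AbstractSimplicialComplex B) : Prop where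
  mem_left : ∀ s : Finset A, s ∈ K ↔ s.Nonempty ∧ ∃ b, ∀ a ∈ s, R a b
  mem_right : ∀ t : Finset B, t ∈ K' ↔ t.Nonempty ∧ ∃ a, ∀ b ∈ t, R a b

namespace RelationComplexes

variable {A B : Type*} {R : A → B → Prop}
  {K : AbstractSimplicialComplex A} {K' : AbstractSimplicialComplex B}

theorem flip (D : RelationComplexes R K K') : RelationComplexes (flip R) K' K :=
  ⟨D.mem_right, D.mem_left⟩

theorem exists_rel [DecidableEq A] (D : RelationComplexes R K K') {u v : A} (h : ({u, v} : Finset A) ∈ K) :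
    ∃ b, R u b ∧ R v b := by
  simpa using ((D.mem_left _).1 h).2

theorem exists_rel₃ [DecidableEq A] (D : RelationComplexes R K K') {u v w : A}
    (h : ({u, v, w} : Finset A) ∈ K) : ∃ b, R u b ∧ R v b ∧ R w b := by
  simpa using ((D.mem_left _).1 h).2

theorem pair_mem [DecidableEq B] (D : RelationComplexes R K K') {a : A} {b c : B} (hb : R a b) (hc : R a c) :
    ({b, c} : Finset B) ∈ K' :=
  (D.mem_right _).2 ⟨by simp, a, by simp [hb, hc]⟩

theorem triple_mem [DecidableEq B] (D : RelationComplexes R K K') {a : A} {b c d : B} (hb : R a b) (hc : R a c)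
    (hd : R a d) : ({b, c, d} : Finset B) ∈ K' :=
  (D.mem_right _).2 ⟨by simp, a, by simp [hb, hc, hd]⟩

variable [DecidableEq A] [DecidableEq B]

/-- An edge-path in `K'` whose `i`-th vertex is related to both ends of the `i`-th edge of the
given edge-path in `K`, joined to the prescribed end points. -/
noncomputable def transport (D : RelationComplexes R K K') :
    {u w : A} → EdgePath K u w → (b c : B) → R u b → R w c → EdgePath K' b c
  | _, _, nil _, _, _, hb, hc => edge (D.pair_mem hb hc)
  | _, _, cons h P, _, c, hb, hc =>
    cons (D.pair_mem hb (D.exists_rel h).choose_spec.1)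
      (transport D P _ c (D.exists_rel h).choose_spec.2 hc)

theorem isConnected_right (D : RelationComplexes R K K') (hK : IsConnected K) : IsConnected K' := by
  intro b c
  obtain ⟨a, ha, -⟩ := D.flip.exists_rel (pair_self_mem K' b)
  obtain ⟨a', ha', -⟩ := D.flip.exists_rel (pair_self_mem K' c)
  obtain ⟨P⟩ := hK a a'
  exact ⟨D.transport P b c ha ha'⟩

variable (D : RelationComplexes R K K')

/-- The old start, the new start and the next vertex of the transported path are all related to `u`,
so they span a simplex. -/
theorem cons_transport {u w : A} (P : EdgePath K u w) {b b' c : B} (hb : R u b) (hb' : R u b')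
    (hc : R w c) :
    Homotopic (cons (D.pair_mem hb' hb) (D.transport P b c hb hc))
      (D.transport P b' c hb' hc) := by
  cases P with
  | nil v => exact .triangle _ _ _ (D.triple_mem hb' hc hb) _
  | cons h P =>
    have hd := (D.exists_rel h).choose_spec.1
    exact .triangle _ _ _ (D.triple_mem hb' hd hb) _

/-- Independence of the choice made in `transport`: the chosen vertex and `d` are both related to
`u` and to `v`, so one triangle at `u` and one shift of the start at `v` exchange them. -/
theorem transport_cons {u v w : A} (h : ({u, v} : Finset A) ∈ K) (P : EdgePath K v w)
    {b c d : B} (hb : R u b) (hc : R w c) (hd : R u d) (hd' : R v d) :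
    Homotopic (D.transport (cons h P) b c hb hc)
      (cons (D.pair_mem hb hd) (D.transport P d c hd' hc)) := by
  have he := (D.exists_rel h).choose_spec.1
  have he' := (D.exists_rel h).choose_spec.2
  refine Homotopic.trans (.symm ?_) (.cons _ (D.cons_transport P he' hd' hc))
  exact .triangle _ _ _ (D.triple_mem hb he hd) _

theorem transport_append {u v w : A} (P : EdgePath K u v) (Q : EdgePath K v w) {b c d : B}
    (hb : R u b) (hc : R w c) (hd : R v d) :
    Homotopic (D.transport (P.append Q) b c hb hc)
      ((D.transport P b d hb hd).append (D.transport Q d c hd hc)) := by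
  induction P generalizing b with
  | nil v => exact Homotopic.symm (D.cons_transport Q hd hb hc)
  | cons h P ih => exact .cons _ (ih Q _ hd)

theorem transport_homotopic {u w : A} {P Q : EdgePath K u w} (hPQ : Homotopic P Q) {b c : B}
    (hb : R u b) (hc : R w c) :
    Homotopic (D.transport P b c hb hc) (D.transport Q b c hb hc) := by
  induction hPQ with
  | refl P => exact .refl _
  | symm P Q _ ih => exact ih.symm
  | trans P Q R _ _ ih ih' => exact ih.trans ih'
  | rel P Q h =>
  cases h with
  -- An element `d` related to all three vertices can serve as the choice for all three edges, so
  -- both sides become stationary at `d` before continuing along `Q`.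
  | triangle P Q h₁₃ h₃₂ h₁₂ h =>
    obtain ⟨d, hd₁, hd₂, hd₃⟩ := D.exists_rel₃ h
    refine Homotopic.trans (D.transport_append _ _ hb hc hd₁)
      (Homotopic.trans (.append (.refl _) ?_) (Homotopic.symm (D.transport_append _ _ hb hc hd₁)))
    refine Homotopic.trans (D.transport_cons h₁₃ _ hd₁ hc hd₁ hd₃) ?_
    refine Homotopic.trans (.repeated _ _) ?_
    refine Homotopic.trans (D.transport_cons h₃₂ _ hd₃ hc hd₃ hd₂) ?_
    exact Homotopic.symm (D.transport_cons h₁₂ _ hd₁ hc hd₁ hd₂)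
  | repeated P Q h =>
    obtain ⟨d, hd, -⟩ := D.exists_rel h
    refine Homotopic.trans (D.transport_append _ _ hb hc hd)
      (Homotopic.trans (.append (.refl _) ?_) (Homotopic.symm (D.transport_append _ _ hb hc hd)))
    exact Homotopic.trans (D.transport_cons h _ hd hc hd hd) (.repeated _ _)

theorem transport_transport {u w : A} (P : EdgePath K u w) {b c : B} (hb : R u b) (hc : R w c) :
    Homotopic (D.flip.transport (D.transport P b c hb hc) u w hb hc) P := by
  induction P generalizing b with
  | nil v =>
    exact Homotopic.trans (D.flip.transport_cons _ _ hb hc hb hc)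
      (Homotopic.trans (.repeated _ _) (.repeated _ _))
  | @cons u v w h P ih =>
    have hd := (D.exists_rel h).choose_spec.1
    have hd' := (D.exists_rel h).choose_spec.2
    -- For the edge from `b` to the chosen vertex, `u` is related to both ends. Taking it produces a
    -- repeated vertex; moving the start from `u` to `v` then splits off the original edge.
    refine Homotopic.trans (D.flip.transport_cons _ _ hb hc hb hd) ?_
    refine Homotopic.trans (.repeated _ _) ?_
    refine Homotopic.trans (Homotopic.symm (D.flip.cons_transport _ hd' hd hc)) ?_
    exact .cons _ (ih hd' hc)

/-- The edge-path groups of the two complexes of a relation are isomorphic. -/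
noncomputable def edgePathGroupEquiv {a : A} {b : B} (h : R a b) :
    EdgePathGroup K a ≃* EdgePathGroup K' b where
  toFun := Quotient.map (fun P => D.transport P b b h h) fun _ _ hP =>
    D.transport_homotopic hP h h
  invFun := Quotient.map (fun P => D.flip.transport P a a h h) fun _ _ hP =>
    D.flip.transport_homotopic hP h h
  left_inv := by
    rintro ⟨P⟩
    exact Quotient.sound (D.transport_transport P h h)
  right_inv := by
    rintro ⟨P⟩
    exact Quotient.sound (D.flip.transport_transport P h h)
  map_mul' := by
    rintro ⟨P⟩ ⟨Q⟩
    exact Quotient.sound (D.transport_append P Q h h h)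

end RelationComplexes

/-! ## The relation of divisibility -/

section Divisibility

variable {X : Set ℕ+}

theorem dvd_setGcd {s : Finset (GVertex X)} {p : ℕ} :
    p ∣ setGcd s ↔ ∀ v ∈ s, p ∣ ((v : ℕ+) : ℕ) :=
  Finset.dvd_gcd_iff

theorem setGcd_ne_zero {s : Finset (GVertex X)} (hs : s.Nonempty) : setGcd s ≠ 0 := by
  obtain ⟨v, hv⟩ := hs
  exact (Nat.pos_of_dvd_of_pos (Finset.gcd_dvd hv) v.1.pos).ne'

theorem mem_eta {s : Finset (GVertex X)} (hs : s ∈ commonDivisorComplex X) {p : DVertex X} :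
    p ∈ (eta ⟨s, hs⟩).1 ↔ ∀ v ∈ s, (p : ℕ) ∣ ((v : ℕ+) : ℕ) := by
  rw [← dvd_setGcd]
  simp only [eta, Finset.mem_subtype, Nat.mem_primeFactors]
  exact ⟨fun h => h.2.1, fun h => ⟨p.2.1, h, setGcd_ne_zero hs.1⟩⟩

theorem relationComplexes (X : Set ℕ+) :
    RelationComplexes (fun (n : GVertex X) (p : DVertex X) => (p : ℕ) ∣ ((n : ℕ+) : ℕ))
      (commonDivisorComplex X) (primeDivisorComplex X) where
  mem_left s := by
    refine and_congr_right fun ⟨v, hv⟩ => ⟨fun h => ?_, fun ⟨p, hp⟩ => ?_⟩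
    · obtain ⟨p, hp, hps⟩ := Nat.exists_prime_and_dvd h.ne'
      have hps := dvd_setGcd.1 hps
      exact ⟨⟨p, hp, v.1, v.2.1, hps v hv⟩, hps⟩
    · exact p.2.1.one_lt.trans_le (Nat.le_of_dvd (Nat.pos_of_ne_zero (setGcd_ne_zero ⟨v, hv⟩))
        (dvd_setGcd.2 hp))
  mem_right t := by
    refine and_congr_right fun ⟨p, hp⟩ => ⟨fun ⟨n, hn, h⟩ => ?_, fun ⟨n, h⟩ => ⟨n.1, n.2.1, h⟩⟩
    refine ⟨⟨n, hn, ?_⟩, h⟩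
    -- Omitting 1 from X loses no simplex, as no prime divides 1.
    rintro rfl
    exact p.2.1.one_lt.ne' (Nat.dvd_one.1 (h p hp))

theorem EtaImage.dvd {u w : GVertex X} {q r : DVertex X}
    {L : EdgePath (commonDivisorComplex X) u w} {M : EdgePath (primeDivisorComplex X) q r}
    (h : EtaImage L M) : (q : ℕ) ∣ ((u : ℕ+) : ℕ) ∧ (r : ℕ) ∣ ((w : ℕ+) : ℕ) := by
  induction h with
  | nil hp => simpa [mem_eta] using hp
  | cons h hp hpq hLM ih => exact ⟨(mem_eta h).1 hp _ (by simp), ih.2⟩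

/-- Consecutive choices both divide the vertex shared by their edges, so any selection is an
edge-path. This is what makes η_* unique. -/
theorem EtaImage.exists {u w : GVertex X} (L : EdgePath (commonDivisorComplex X) u w) :
    ∃ (q r : DVertex X) (M : EdgePath (primeDivisorComplex X) q r), EtaImage L M := by
  induction L with
  | nil v =>
    obtain ⟨q, hq, -⟩ := (relationComplexes X).exists_rel (pair_self_mem _ v)
    exact ⟨q, q, .nil q, .nil ((mem_eta _).2 (by simpa using hq))⟩
  | cons h L ih =>
    obtain ⟨q, r, M, hM⟩ := ih
    obtain ⟨p, hp, hp'⟩ := (relationComplexes X).exists_rel h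
    exact ⟨p, r, .cons ((relationComplexes X).pair_mem hp' hM.dvd.1) M,
      .cons h ((mem_eta h).2 (by simp [hp, hp'])) _ hM⟩

/-- Each ωᵢ is an admissible choice for the transport of the i-th edge. All choices of η_*(L) are
thus homotopic once closed up, so η_* is well defined. -/
theorem EtaImage.homotopic {u w : GVertex X} {q r : DVertex X}
    {L : EdgePath (commonDivisorComplex X) u w} {M : EdgePath (primeDivisorComplex X) q r}
    (h : EtaImage L M) {b c : DVertex X} (hb : (b : ℕ) ∣ ((u : ℕ+) : ℕ))
    (hc : (c : ℕ) ∣ ((w : ℕ+) : ℕ)) (hq : ({b, q} : Finset (DVertex X)) ∈ primeDivisorComplex X)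
    (hr : ({r, c} : Finset (DVertex X)) ∈ primeDivisorComplex X) :
    Homotopic ((edge hq).append (M.append (edge hr)))
      ((relationComplexes X).transport L b c hb hc) := by
  have D := relationComplexes X
  induction h generalizing b with
  | @nil v p hp =>
    have hp : (p : ℕ) ∣ ((v : ℕ+) : ℕ) := by simpa [mem_eta] using hp
    exact .triangle _ _ _ (D.triple_mem hb hc hp) _
  | @cons u v w p q r L M h hp hpq hLM ih =>
    have hu := (mem_eta h).1 hp u (by simp)
    have hv := (mem_eta h).1 hp v (by simp)
    exact Homotopic.trans (.cons _ (ih hv hc hpq hr)) (Homotopic.symm (D.transport_cons h L hb hc hu hv))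

end Divisibility

/-! ## Open stars and closed simplices of the geometric realization -/

namespace Realization

open Topology

variable {V : Type*} {K : AbstractSimplicialComplex V}

theorem continuous_iff_ofSimplex {Y : Type*} [TopologicalSpace Y] {f : Realization K → Y} :
    Continuous f ↔ ∀ s : {s : Finset V // s ∈ K}, Continuous (f ∘ ofSimplex s) := by
  simp only [continuous_iSup_dom, continuous_coinduced_dom]

theorem continuous_coord : Continuous (coord : Realization K → V → ℝ) :=
  continuous_iff_ofSimplex.2 fun _ => continuous_subtype_val

/-- The disjoint union of the closed simplices, mapped to the realization. -/
def ofSigma (K : AbstractSimplicialComplex V)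
    (x : Σ s : {s : Finset V // s ∈ K}, closedSimplex s.1) : Realization K :=
  ofSimplex x.1 x.2

/-- In this form the weak topology can be restricted to open sets and multiplied by the unit
interval. -/
theorem isQuotientMap_ofSigma (K : AbstractSimplicialComplex V) : IsQuotientMap (ofSigma K) := by
  refine (isQuotientMap_iff _).2 ⟨isCoinducing_iff.2 fun U => ?_, fun x => ?_⟩
  · simp only [isOpen_iSup_iff, isOpen_coinduced]
    rfl
  · obtain ⟨s, hs, hx⟩ := x.mem_simplex
    exact ⟨⟨⟨s, hs⟩, ⟨x.coord, hx⟩⟩, rfl⟩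

/-- The open star of a vertex. -/
def openStar (K : AbstractSimplicialComplex V) (v : V) : Set (Realization K) :=
  {x | 0 < x.coord v}

theorem isOpen_openStar (v : V) : IsOpen (openStar K v) :=
  isOpen_lt continuous_const ((continuous_apply v).comp continuous_coord)

theorem exists_mem_openStar (x : Realization K) : ∃ v, x ∈ openStar K v := by
  obtain ⟨s, -, h0, -, h1⟩ := x.mem_simplex
  by_contra! h
  have : ∀ v ∈ s, x.coord v = 0 := fun v _ => le_antisymm (not_lt.1 (h v)) (h0 v)
  rw [Finset.sum_eq_zero this] at h1
  exact zero_ne_one h1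

theorem mem_of_mem_openStar {x : Realization K} {v : V} (hv : x ∈ openStar K v) {s : Finset V}
    (hs : x.coord ∈ closedSimplex s) : v ∈ s := by
  by_contra h
  exact (ne_of_gt hv) (hs.2.1 v h)

theorem mem_of_subset {s t : Finset V} (hs : s ∈ K) (hts : t ⊆ s) (ht : t.Nonempty) : t ∈ K :=
  (K.isRelLowerSet_faces hs).2 hts ht

/-- Every simplex carrying a point contains all vertices at which the point has a positive
coordinate. -/
theorem pair_mem_of_mem_openStar [DecidableEq V] {x : Realization K} {u v : V}
    (hu : x ∈ openStar K u) (hv : x ∈ openStar K v) : ({u, v} : Finset V) ∈ K := by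
  obtain ⟨s, hs, hx⟩ := x.mem_simplex
  refine mem_of_subset hs ?_ (by simp)
  simp [Finset.insert_subset_iff, mem_of_mem_openStar hu hx, mem_of_mem_openStar hv hx]

theorem triple_mem_of_mem_openStar [DecidableEq V] {x : Realization K} {u v w : V}
    (hu : x ∈ openStar K u) (hv : x ∈ openStar K v) (hw : x ∈ openStar K w) :
    ({u, v, w} : Finset V) ∈ K := by
  obtain ⟨s, hs, hx⟩ := x.mem_simplex
  refine mem_of_subset hs ?_ (by simp)
  simp [Finset.insert_subset_iff, mem_of_mem_openStar hu hx, mem_of_mem_openStar hv hx,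
    mem_of_mem_openStar hw hx]

theorem vertex_mem_openStar [DecidableEq V] {u v : V} : vertex K u ∈ openStar K v ↔ u = v := by
  by_cases h : v = u
  · subst h; simp [openStar, vertex]
  · simp [openStar, vertex, h, Ne.symm h]

theorem convex_closedSimplex (s : Finset V) : Convex ℝ (closedSimplex s) := by
  intro x hx y hy a b ha hb hab
  refine ⟨fun v => ?_, fun v hv => ?_, ?_⟩
  · exact add_nonneg (mul_nonneg ha (hx.1 v)) (mul_nonneg hb (hy.1 v))
  · simp [hx.2.1 v hv, hy.2.1 v hv]
  · simp [Finset.sum_add_distrib, ← Finset.mul_sum, hx.2.2, hy.2.2, hab]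

theorem closedSimplex_mono {s t : Finset V} (h : s ⊆ t) : closedSimplex s ⊆ closedSimplex t := by
  intro x hx
  refine ⟨hx.1, fun v hv => hx.2.1 v fun hvs => hv (h hvs), ?_⟩
  rw [← hx.2.2]
  exact (Finset.sum_subset h fun v _ hv => hx.2.1 v hv).symm

/-- Two paths in a closed simplex with the same ends are homotopic. -/
theorem homotopic_of_mem_closedSimplex {s : Finset V} (hs : s ∈ K) {x y : Realization K}
    (p q : Path x y) (hp : ∀ t, (p t).coord ∈ closedSimplex s)
    (hq : ∀ t, (q t).coord ∈ closedSimplex s) : p.Homotopic q := by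
  have : ContractibleSpace (closedSimplex s) :=
    (convex_closedSimplex s).contractibleSpace ⟨_, hp 0⟩
  -- Paths lift to the closed simplex because the coordinates are continuous on the realization.
  have key : ∀ r : Path x y, (hr : ∀ t, (r t).coord ∈ closedSimplex s) → ∃ r' : Path
      (⟨x.coord, by simpa using hp 0⟩ : closedSimplex s) ⟨y.coord, by simpa using hp 1⟩,
      r'.map (continuous_ofSimplex ⟨s, hs⟩) = r := fun r hr =>
    ⟨⟨⟨fun t => ⟨(r t).coord, hr t⟩, (continuous_coord.comp r.continuous).subtype_mk _⟩,
      by simp, by simp⟩, rfl⟩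
  obtain ⟨p', hp'⟩ := key p hp
  obtain ⟨q', hq'⟩ := key q hq
  rw [← hp', ← hq']
  exact (SimplyConnectedSpace.paths_homotopic p' q').map ⟨_, continuous_ofSimplex ⟨s, hs⟩⟩

/-! ### Contractibility of open stars. -/

variable [DecidableEq V]

theorem single_mem_closedSimplex {s : Finset V} {v : V} (hv : v ∈ s) :
    (Pi.single v 1 : V → ℝ) ∈ closedSimplex s :=
  closedSimplex_mono (Finset.singleton_subset_iff.2 hv) (single_mem v)

/-- Moving a point of an open star towards the vertex, in coordinates. -/
def contraction (v : V) (x : V → ℝ) (t : ℝ) : V → ℝ :=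
  (1 - t) • Pi.single v 1 + t • x

theorem contraction_mem {s : Finset V} {v : V} (hv : v ∈ s) {x : V → ℝ}
    (hx : x ∈ closedSimplex s) (t : unitInterval) : contraction v x t ∈ closedSimplex s :=
  convex_closedSimplex s (single_mem_closedSimplex hv) hx (sub_nonneg.2 t.2.2) t.2.1 (by simp)

/-- The contraction of the open star of a vertex to that vertex. -/
def contract (v : V) (x : openStar K v) (t : unitInterval) : Realization K :=
  ⟨contraction v x.1.coord t, by
    obtain ⟨s, hs, hx⟩ := x.1.mem_simplex
    exact ⟨s, hs, contraction_mem (mem_of_mem_openStar x.2 hx) hx t⟩⟩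

theorem contract_mem (v : V) (x : openStar K v) (t : unitInterval) :
    contract v x t ∈ openStar K v := by
  have hx : 0 < x.1.coord v := x.2
  simp only [contract, contraction, openStar, Set.mem_ofPred_eq, Pi.add_apply, Pi.smul_apply,
    Pi.single_eq_same, smul_eq_mul, mul_one]
  rcases t.2.1.eq_or_lt with h | h
  · simp [← h]
  · nlinarith [t.2.2, mul_pos h hx]

theorem contract_zero (v : V) (x : openStar K v) : contract v x 0 = vertex K v := by
  ext w; simp [contract, contraction, vertex]

theorem contract_one (v : V) (x : openStar K v) : contract v x 1 = x := by
  ext w; simp [contract, contraction]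

/-- A quotient map restricted over an open set and multiplied by the locally compact unit interval
is still a quotient map. Continuity may therefore be checked on each closed simplex, where the
formula is polynomial in the coordinates and the time. -/
theorem continuous_contract (v : V) :
    Continuous fun p : openStar K v × unitInterval => contract v p.1 p.2 := by
  have hq := (isQuotientMap_ofSigma K).restrictPreimage_isOpen (isOpen_openStar v)
  refine hq.continuous_lift_prod_left (continuous_iff_continuousAt.2 ?_)
  rintro ⟨⟨⟨s, x⟩, hx⟩, t⟩
  have he := ((ofSigma K ⁻¹' openStar K v).restrictPreimage_isOpenEmbedding
    (IsOpenEmbedding.sigmaMk (i := s))).prodMap (IsOpenEmbedding.id (X := unitInterval))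
  refine (he.continuousAt_iff (x := (⟨x, hx⟩, t))).1 (Continuous.continuousAt ?_)
  have hv : v ∈ s.1 := mem_of_mem_openStar hx x.2
  refine (continuous_ofSimplex s).comp (f := fun p : (Sigma.mk s ⁻¹' (ofSigma K ⁻¹' openStar K v)) ×
    unitInterval => ⟨contraction v p.1.1.1 p.2,
    contraction_mem hv p.1.1.2 p.2⟩) (Continuous.subtype_mk ?_ _)
  unfold contraction
  fun_prop

instance (v : V) : ContractibleSpace (openStar K v) := by
  refine (contractible_iff_id_nullhomotopic _).2 ⟨⟨vertex K v, vertex_mem_openStar.2 rfl⟩, ⟨?_⟩⟩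
  refine ContinuousMap.Homotopy.symm
    { toFun := fun p => ⟨contract v p.2 p.1, contract_mem v p.2 p.1⟩
      continuous_toFun := ((continuous_contract v).comp continuous_swap).subtype_mk _
      map_zero_left := fun x => Subtype.ext (contract_zero v x)
      map_one_left := fun x => Subtype.ext (contract_one v x) }

/-- Two paths in an open star with the same ends are homotopic. -/
theorem homotopic_of_mem_openStar {v : V} {x y : Realization K}
    (p q : Path x y) (hp : ∀ t, p t ∈ openStar K v) (hq : ∀ t, q t ∈ openStar K v) :
    p.Homotopic q := by
  have key : ∀ r : Path x y, (hr : ∀ t, r t ∈ openStar K v) → ∃ r' : Path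
      (⟨x, by simpa using hp 0⟩ : openStar K v) ⟨y, by simpa using hp 1⟩,
      r'.map continuous_subtype_val = r := fun r hr =>
    ⟨⟨⟨fun t => ⟨r t, hr t⟩, r.continuous.subtype_mk _⟩, by simp, by simp⟩, rfl⟩
  obtain ⟨p', hp'⟩ := key p hp
  obtain ⟨q', hq'⟩ := key q hq
  rw [← hp', ← hq']
  exact (SimplyConnectedSpace.paths_homotopic p' q').map ⟨_, continuous_subtype_val⟩

/-- The straight path from a vertex to a point of its open star. -/
def segment (v : V) (x : openStar K v) : Path (vertex K v) x.1 where
  toFun := contract v x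
  continuous_toFun := (continuous_contract v).comp (Continuous.prodMk_right x)
  source' := contract_zero v x
  target' := contract_one v x

end Realization

/-! ## From edge-paths to paths in the realization -/

section PathClass

open Realization

variable {V : Type*} [DecidableEq V] {K : AbstractSimplicialComplex V}

theorem Realization.trans_mem {Y : Type*} [TopologicalSpace Y] {S : Set Y} {x y z : Y}
    {p : Path x y} {q : Path y z} (hp : ∀ t, p t ∈ S) (hq : ∀ t, q t ∈ S) (t : unitInterval) :
    p.trans q t ∈ S := by
  rw [Path.trans_apply]
  split_ifs
  exacts [hp _, hq _]

theorem Realization.edgePath_mem {u v : V} (h : ({u, v} : Finset V) ∈ K) {s : Finset V}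
    (hs : {u, v} ⊆ s) (t : unitInterval) :
    edgePath h t ∈ (coord : Realization K → V → ℝ) ⁻¹' closedSimplex s :=
  closedSimplex_mono hs (segment_mem u v t)

theorem Realization.segment_mem_closedSimplex {v : V} (x : openStar K v) {s : Finset V}
    (hs : x.1.coord ∈ closedSimplex s) (t : unitInterval) :
    segment v x t ∈ (coord : Realization K → V → ℝ) ⁻¹' closedSimplex s :=
  contraction_mem (mem_of_mem_openStar x.2 hs) hs t

namespace EdgePath

/-- The homotopy class of the path in `|K|` traced out by an edge-path. -/
noncomputable def pathClass {u v : V} (P : EdgePath K u v) :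
    Path.Homotopic.Quotient (vertex K u) (vertex K v) :=
  .mk P.toPath

theorem pathClass_cons {u v w : V} (h : ({u, v} : Finset V) ∈ K) (P : EdgePath K v w) :
    (cons h P).pathClass = .trans (.mk (edgePath h)) P.pathClass :=
  rfl

theorem pathClass_nil (v : V) : (nil v : EdgePath K v v).pathClass = .refl _ :=
  rfl

theorem pathClass_append {u v w : V} (P : EdgePath K u v) (Q : EdgePath K v w) :
    (P.append Q).pathClass = P.pathClass.trans Q.pathClass := by
  induction P with
  | nil v => rw [pathClass_nil, Path.Homotopic.Quotient.refl_trans]; rfl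
  | cons h P ih =>
    rw [append, pathClass_cons, pathClass_cons, ih, Path.Homotopic.Quotient.trans_assoc]

theorem pathClass_edge {u v : V} (h : ({u, v} : Finset V) ∈ K) :
    (edge h).pathClass = .mk (edgePath h) :=
  Path.Homotopic.Quotient.trans_refl (.mk (edgePath h))

/-- Each simple equivalence takes place inside a single closed simplex, which is convex. -/
theorem Homotopic.pathClass_eq {u v : V} {P Q : EdgePath K u v} (h : Homotopic P Q) :
    P.pathClass = Q.pathClass := by
  induction h with
  | refl P => rfl
  | symm P Q _ ih => exact ih.symm
  | trans P Q R _ _ ih ih' => exact ih.trans ih'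
  | rel P Q h =>
    cases h with
    | triangle P Q h₁₃ h₃₂ h₁₂ h =>
      have e : (Path.Homotopic.Quotient.mk (edgePath h₁₃)).trans (.mk (edgePath h₃₂)) =
          .mk (edgePath h₁₂) := by
        refine Path.Homotopic.Quotient.eq.2 (homotopic_of_mem_closedSimplex h _ _
          (trans_mem (edgePath_mem h₁₃ ?_) (edgePath_mem h₃₂ ?_)) (edgePath_mem h₁₂ ?_)) <;> grind
      simp only [pathClass_append, pathClass_cons]
      rw [← e, Path.Homotopic.Quotient.trans_assoc]
    | repeated P Q h =>
      simp only [pathClass_append, pathClass_cons]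
      rw [Path.Homotopic.Quotient.eq.2 (homotopic_of_mem_closedSimplex h (edgePath h) (.refl _)
        (edgePath_mem h (by simp)) fun t => single_mem_closedSimplex (by simp)),
        Path.Homotopic.Quotient.mk_refl, Path.Homotopic.Quotient.refl_trans]

end EdgePath

open EdgePath

/-- Every path in `|K|` between vertices is homotopic to an edge-path. -/
theorem exists_pathClass_eq {v w : V} (γ : Path (vertex K v) (vertex K w)) :
    ∃ P : EdgePath K v w, P.pathClass = .mk γ := by
  obtain ⟨t, ht0, htm, ⟨N, hN⟩, hsub⟩ := exists_monotone_Icc_subset_open_cover_unitInterval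
    (c := fun i => γ ⁻¹' openStar K i) (fun i => (isOpen_openStar i).preimage γ.continuous)
    (fun s _ => Set.mem_iUnion.2 (exists_mem_openStar (γ s)))
  -- The claim is made for every star containing `γ (t n)`, so that the inductive step may use the
  -- star containing the next piece of `γ`.
  have key : ∀ n u (hu : γ (t n) ∈ openStar K u), ∃ P : EdgePath K v u,
      P.pathClass.trans (.mk (segment u ⟨γ (t n), hu⟩)) =
        .mk ((γ.subpath 0 (t n)).cast γ.source.symm rfl) := by
    intro n
    induction n with
    | zero =>
      rw [ht0]
      intro u hu
      obtain rfl : v = u := vertex_mem_openStar.1 (by simpa using hu)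
      refine ⟨nil v, ?_⟩
      rw [pathClass_nil, Path.Homotopic.Quotient.refl_trans, Path.Homotopic.Quotient.eq]
      refine homotopic_of_mem_openStar _ _ (contract_mem v _) fun s => ?_
      simpa using hu
    | succ n ih =>
      intro u hu
      obtain ⟨i, hi⟩ := hsub n
      have hle := htm n.le_succ
      have h₀ : γ (t n) ∈ openStar K i := hi ⟨le_rfl, hle⟩
      have h₁ : γ (t (n + 1)) ∈ openStar K i := hi ⟨hle, le_rfl⟩
      obtain ⟨P, hP⟩ := ih i h₀
      have hiu := pair_mem_of_mem_openStar h₁ hu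
      refine ⟨P.append (edge hiu), ?_⟩
      -- This homotopy lives in a closed simplex carrying `γ (t (n + 1))`; the next one lives in the
      -- open star of `i`.
      have e₁ : (Path.Homotopic.Quotient.mk (edgePath hiu)).trans (.mk (segment u ⟨_, hu⟩)) =
          .mk (segment i ⟨_, h₁⟩) := by
        obtain ⟨s, hs, hx⟩ := (γ (t (n + 1))).mem_simplex
        have hi := mem_of_mem_openStar h₁ hx
        have hu' := mem_of_mem_openStar hu hx
        exact Path.Homotopic.Quotient.eq.2 (homotopic_of_mem_closedSimplex hs _ _
          (trans_mem (edgePath_mem hiu (by grind)) (segment_mem_closedSimplex _ hx))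
          (segment_mem_closedSimplex ⟨_, h₁⟩ hx))
      have e₂ : (Path.Homotopic.Quotient.mk (segment i ⟨_, h₀⟩)).trans
          (.mk (γ.subpath (t n) (t (n + 1)))) = .mk (segment i ⟨_, h₁⟩) := by
        refine Path.Homotopic.Quotient.eq.2 (homotopic_of_mem_openStar _ _
          (trans_mem (contract_mem i _) fun s => ?_) (contract_mem i ⟨_, h₁⟩))
        have : γ.subpath (t n) (t (n + 1)) s ∈ γ '' Set.Icc (t n) (t (n + 1)) :=
          γ.range_subpath_of_le _ _ hle ▸ Set.mem_range_self s
        obtain ⟨r, hr, hrs⟩ := this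
        exact hrs ▸ hi hr
      rw [pathClass_append, pathClass_edge, Path.Homotopic.Quotient.trans_assoc, e₁, ← e₂,
        ← Path.Homotopic.Quotient.trans_assoc, hP]
      exact Path.Homotopic.Quotient.eq.2
        (Path.Homotopic.pathCast ⟨.subpathTransSubpath γ 0 (t n) (t (n + 1))⟩ γ.source.symm rfl)
  have key := key N
  rw [hN N le_rfl] at key
  have hw : γ 1 ∈ openStar K w := by simpa using vertex_mem_openStar.2 rfl
  obtain ⟨P, hP⟩ := key w hw
  refine ⟨P, ?_⟩
  have h₁ := Path.Homotopic.pathCast (Path.Homotopic.Quotient.eq.1 hP) rfl γ.target.symm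
  have h₂ : (segment w ⟨γ 1, hw⟩).cast rfl γ.target.symm |>.Homotopic (.refl _) :=
    homotopic_of_mem_openStar (v := w) _ _ (contract_mem w _) fun _ => vertex_mem_openStar.2 rfl
  have h₃ : (P.toPath.trans ((segment w ⟨γ 1, hw⟩).cast rfl γ.target.symm)).Homotopic γ := by
    rw [Path.subpath_zero_one] at h₁
    exact h₁
  rw [← Path.Homotopic.Quotient.eq.2 h₃, Path.Homotopic.Quotient.mk_trans,
    Path.Homotopic.Quotient.eq.2 h₂]
  exact (Path.Homotopic.Quotient.trans_refl _).symm

end PathClass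

/-! ## The covering space with fibre the edge-path group -/

section Covering

open Realization EdgePath

variable {V : Type*} [DecidableEq V] {K : AbstractSimplicialComplex V} {v : V}

theorem EdgePathGroup.mk_eq_mk {P Q : EdgePath K v v} :
    EdgePathGroup.mk P = EdgePathGroup.mk Q ↔ Homotopic P Q :=
  Quotient.eq (r := homotopicSetoid K v)

/-- The class of the edge-path `P`, closed up by means of chosen edge-paths from the base
vertex to all the vertices. -/
def holonomy (τ : ∀ w, EdgePath K v w) {u w : V} (P : EdgePath K u w) : EdgePathGroup K v :=
  EdgePathGroup.mk ((τ u).append (P.append (τ w).reverse))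

section Holonomy

variable (τ : ∀ w, EdgePath K v w)

theorem holonomy_nil (u : V) : holonomy τ (nil u) = 1 :=
  EdgePathGroup.mk_eq_mk.2 (append_reverse_self (τ u))

theorem EdgePath.Homotopic.holonomy_eq {u w : V} {P Q : EdgePath K u w} (h : Homotopic P Q) :
    holonomy τ P = holonomy τ Q :=
  EdgePathGroup.mk_eq_mk.2 (.append (.refl _) (h.append (.refl _)))

theorem holonomy_append {u w x : V} (P : EdgePath K u w) (Q : EdgePath K w x) :
    holonomy τ (P.append Q) = holonomy τ P * holonomy τ Q := by
  refine EdgePathGroup.mk_eq_mk.2 ?_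
  simp only [append_assoc]
  refine .append (.refl _) (.append (.refl _) ?_)
  rw [← append_assoc]
  exact Homotopic.symm ((reverse_append_self (τ w)).append (.refl _))

/-- Undoing the closing paths recovers the edge-path from its holonomy. -/
theorem homotopic_of_holonomy_eq {u w : V} {P Q : EdgePath K u w}
    (h : holonomy τ P = holonomy τ Q) : Homotopic P Q := by
  have key : ∀ R : EdgePath K u w, Homotopic
      ((τ u).reverse.append (((τ u).append (R.append (τ w).reverse)).append (τ w))) R := by
    intro R
    simp only [append_assoc]
    rw [← append_assoc]
    refine ((reverse_append_self (τ u)).append (.refl _)).trans ?_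
    simpa only [append, append_nil] using
      (Homotopic.refl R).append (reverse_append_self (τ w))
  exact (key P).symm.trans
    (((Homotopic.refl _).append ((EdgePathGroup.mk_eq_mk.1 h).append (.refl _))).trans (key Q))

theorem holonomy_edge_mul {u w x : V} (h : ({u, w} : Finset V) ∈ K)
    (h' : ({w, x} : Finset V) ∈ K) (h'' : ({u, x} : Finset V) ∈ K)
    (ht : ({u, x, w} : Finset V) ∈ K) :
    holonomy τ (edge h) * holonomy τ (edge h') = holonomy τ (edge h'') := by
  rw [← holonomy_append]
  exact Homotopic.holonomy_eq τ (.triangle h h' h'' ht _)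

end Holonomy

instance : TopologicalSpace (EdgePathGroup K v) := ⊥

instance : DiscreteTopology (EdgePathGroup K v) := ⟨rfl⟩

open Classical in
/-- The principal bundle over `|K|`, trivial over open stars, whose transition functions are the
holonomies of the edges. -/
noncomputable def holonomyBundle (τ : ∀ w, EdgePath K v w) :
    FiberBundleCore V (Realization K) (EdgePathGroup K v) where
  baseSet := openStar K
  isOpen_baseSet := isOpen_openStar
  indexAt x := (exists_mem_openStar x).choose
  mem_baseSet_at x := (exists_mem_openStar x).choose_spec
  -- If `i` and `j` do not span a simplex, their stars are disjoint and the value is a mere default.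
  coordChange i j _ g :=
    if h : ({i, j} : Finset V) ∈ K then g * holonomy τ (edge h) else g
  coordChange_self i x hx g := by
    have h := pair_mem_of_mem_openStar hx hx
    rw [dif_pos h, Homotopic.holonomy_eq τ (P := edge h) (.repeated h _), holonomy_nil, mul_one]
  continuousOn_coordChange i j := (continuous_of_discreteTopology (f := fun g =>
    if h : ({i, j} : Finset V) ∈ K then g * holonomy τ (edge h) else g).comp
      continuous_snd).continuousOn
  coordChange_comp i j k x hx g := by
    -- The cocycle condition: three stars meet only over a simplex, around which holonomies
    -- multiply.
    obtain ⟨⟨hi, hj⟩, hk⟩ := hx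
    have hij := pair_mem_of_mem_openStar hi hj
    have hjk := pair_mem_of_mem_openStar hj hk
    have hik := pair_mem_of_mem_openStar hi hk
    rw [dif_pos hij, dif_pos hjk, dif_pos hik, mul_assoc,
      holonomy_edge_mul τ hij hjk hik (triple_mem_of_mem_openStar hi hk hj)]

/-! ### Monodromy along edge-paths. -/

section Monodromy

variable (τ : ∀ w, EdgePath K v w)

theorem isCoveringMap_holonomyBundle : IsCoveringMap (holonomyBundle τ).proj :=
  FiberBundle.isCoveringMap (F := EdgePathGroup K v) (E := (holonomyBundle τ).Fiber)

/-- The point over `x` with coordinate `g` in the chart over the open star of `i`. -/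
noncomputable def fiberPoint (i : V) (x : Realization K) (g : EdgePathGroup K v) :
    (holonomyBundle τ).proj ⁻¹' {x} :=
  ⟨((holonomyBundle τ).localTriv i).toOpenPartialHomeomorph.symm (x, g), rfl⟩

theorem fiberPoint_change {i j : V} {x : Realization K} (hi : x ∈ openStar K i)
    (hj : x ∈ openStar K j) (h : ({i, j} : Finset V) ∈ K) (g : EdgePathGroup K v) :
    fiberPoint τ j x (g * holonomy τ (edge h)) = fiberPoint τ i x g := by
  -- Points of the total space are recorded in the preferred chart at `x`, so the cocycle condition
  -- is applied with that chart as the third.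
  have := (holonomyBundle τ).coordChange_comp i j ((holonomyBundle τ).indexAt x) x
    ⟨⟨hi, hj⟩, (holonomyBundle τ).mem_baseSet_at x⟩ g
  rw [show (holonomyBundle τ).coordChange i j x g = g * holonomy τ (edge h) from dif_pos h] at this
  exact Subtype.ext (congrArg (Bundle.TotalSpace.mk x) this)

theorem fiberPoint_injective {i : V} {x : Realization K} (hi : x ∈ openStar K i) :
    Function.Injective (fiberPoint τ i x) := by
  intro g g' h
  have := ((holonomyBundle τ).localTriv i).toOpenPartialHomeomorph.symm.injOn
    (x₁ := (x, g)) (x₂ := (x, g')) ⟨hi, trivial⟩ ⟨hi, trivial⟩ (congrArg Subtype.val h)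
  exact congrArg Prod.snd this

/-- Over a single star the lift has constant fibre coordinate. -/
theorem monodromy_of_mem_openStar {i : V} {x y : Realization K} (γ : Path x y)
    (hγ : ∀ t, γ t ∈ openStar K i) (g : EdgePathGroup K v) :
    (isCoveringMap_holonomyBundle τ).monodromy (.mk γ) (fiberPoint τ i x g) =
      fiberPoint τ i y g := by
  let e := ((holonomyBundle τ).localTriv i).toOpenPartialHomeomorph.symm
  have hc : Continuous fun t => e (γ t, g) :=
    e.continuousOn.comp_continuous (γ.continuous.prodMk continuous_const)
      fun t => ⟨hγ t, trivial⟩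
  refine (isCoveringMap_holonomyBundle τ).monodromy_eq_of_map_eq
    (.mk ⟨⟨fun t => e (γ t, g), hc⟩, ?_, ?_⟩) ?_
  · exact congrArg (fun z => e (z, g)) γ.source
  · exact congrArg (fun z => e (z, g)) γ.target
  · rfl

theorem monodromy_edgePath {u w : V} (h : ({u, w} : Finset V) ∈ K) (g : EdgePathGroup K v) :
    (isCoveringMap_holonomyBundle τ).monodromy (.mk (edgePath h))
      (fiberPoint τ u (vertex K u) g) =
        fiberPoint τ w (vertex K w) (g * holonomy τ (edge h)) := by
  -- The midpoint lies in both stars: the edge is run in the star of `u` up to `m`, the chart is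
  -- changed there, and the rest lies in the star of `w`.
  let m := edgePath h ⟨1 / 2, by norm_num, by norm_num⟩
  have hm : ∀ z, m.coord z = (1 - 1 / 2) * (Pi.single u 1 : V → ℝ) z +
    1 / 2 * (Pi.single w 1 : V → ℝ) z := fun z => rfl
  have hs : ∀ a b : V, (0 : ℝ) ≤ (Pi.single a 1 : V → ℝ) b := fun a b => (single_mem a).1 b
  have hu : m ∈ openStar K u := by
    have h1 := hs w u
    have h2 := hm u
    rw [Pi.single_eq_same] at h2
    show 0 < m.coord u
    linarith
  have hw : m ∈ openStar K w := by
    have h1 := hs u w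
    have h2 := hm w
    rw [Pi.single_eq_same] at h2
    show 0 < m.coord w
    linarith
  have hms : m.coord ∈ closedSimplex {u, w} := edgePath_mem h subset_rfl _
  have e : Path.Homotopic.Quotient.mk (edgePath h) =
      .trans (.mk (segment u ⟨m, hu⟩)) (.mk (segment w ⟨m, hw⟩).symm) :=
    Path.Homotopic.Quotient.eq.2 (homotopic_of_mem_closedSimplex h _ _
      (edgePath_mem h subset_rfl) (trans_mem (segment_mem_closedSimplex ⟨m, hu⟩ hms)
        fun _ => segment_mem_closedSimplex ⟨m, hw⟩ hms _))
  rw [e, IsCoveringMap.monodromy_trans_apply,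
    monodromy_of_mem_openStar τ _ (contract_mem u ⟨m, hu⟩), ← fiberPoint_change τ hu hw h,
    monodromy_of_mem_openStar τ _ fun _ => contract_mem w ⟨m, hw⟩ _]

theorem monodromy_pathClass {u w : V} (P : EdgePath K u w) (g : EdgePathGroup K v) :
    (isCoveringMap_holonomyBundle τ).monodromy P.pathClass (fiberPoint τ u (vertex K u) g) =
      fiberPoint τ w (vertex K w) (g * holonomy τ P) := by
  induction P generalizing g with
  | nil u => rw [pathClass_nil, IsCoveringMap.monodromy_refl, holonomy_nil, mul_one, id]
  | cons h P ih =>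
    rw [pathClass_cons, IsCoveringMap.monodromy_trans_apply, monodromy_edgePath, ih, mul_assoc,
      ← holonomy_append]
    rfl

end Monodromy

/-- Edge-paths in a connected complex are homotopic if they are so in the realization. -/
theorem homotopic_of_pathClass_eq (hK : IsConnected K) {u w : V} {P Q : EdgePath K u w}
    (h : P.pathClass = Q.pathClass) : Homotopic P Q := by
  let τ := fun w => (hK u w).some
  -- Lifts of both paths from the point with coordinate 1 end at the same point, so their holonomies
  -- agree.
  have e := monodromy_pathClass τ P 1
  rw [h, monodromy_pathClass, one_mul, one_mul] at e
  exact homotopic_of_holonomy_eq τ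
    (fiberPoint_injective τ (vertex_mem_openStar.2 rfl) e).symm

/-- For a connected complex, the edge-path group is anti-isomorphic to the fundamental group of
the realization, where the latter multiplies loops in the order of composition of arrows. -/
noncomputable def edgePathGroupEquivFundamentalGroup (hK : IsConnected K) (v : V) :
    (EdgePathGroup K v)ᵐᵒᵖ ≃* FundamentalGroup (Realization K) (vertex K v) :=
  MulEquiv.ofBijective (M := (EdgePathGroup K v)ᵐᵒᵖ) (F := (EdgePathGroup K v)ᵐᵒᵖ →* _)
    { toFun := fun x => Quotient.lift (fun P : EdgePath K v v => P.toFundamentalGroup)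
        (fun _ _ h => Homotopic.pathClass_eq h) x.unop
      map_one' := rfl
      map_mul' := by
        rintro ⟨⟨P⟩⟩ ⟨⟨Q⟩⟩
        exact pathClass_append Q P } <| by
    constructor
    · rintro ⟨⟨P⟩⟩ ⟨⟨Q⟩⟩ h
      exact congrArg MulOpposite.op (Quotient.sound (homotopic_of_pathClass_eq hK h))
    · rintro ⟨γ⟩
      obtain ⟨P, hP⟩ := exists_pathClass_eq γ
      exact ⟨.op (EdgePathGroup.mk P), hP⟩

end Covering

/-! ## The isomorphism -/

section Main

variable {X : Set ℕ+}

theorem etaStarIsIsomorphism (hX : IsConnected (commonDivisorComplex X)) :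
    EtaStarIsIsomorphism X := by
  intro v p hp
  have D := relationComplexes X
  have hpv : (p : ℕ) ∣ ((v : ℕ+) : ℕ) := by simpa [mem_eta] using hp
  let Ψ := D.edgePathGroupEquiv hpv
  have hΨ : IsEtaStar (v := v) (p := p) Ψ := fun L q r M hq hr h =>
    (EdgePathGroup.mk_eq_mk.2 (h.homotopic hpv hpv hq hr)).symm
  have hex : ∀ L : EdgePath (commonDivisorComplex X) v v, ∃ (q r : DVertex X)
      (M : EdgePath (primeDivisorComplex X) q r)
      (_ : ({p, q} : Finset (DVertex X)) ∈ primeDivisorComplex X)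
      (_ : ({r, p} : Finset (DVertex X)) ∈ primeDivisorComplex X), EtaImage L M := fun L => by
    obtain ⟨q, r, M, h⟩ := EtaImage.exists L
    exact ⟨q, r, M, D.pair_mem hpv h.dvd.1, D.pair_mem h.dvd.2 hpv, h⟩
  refine ⟨⟨Ψ, hΨ, fun f hf => ?_⟩, ?_⟩
  · ext ⟨L⟩
    obtain ⟨q, r, M, hq, hr, h⟩ := hex L
    exact (hf L q r M hq hr h).trans (hΨ L q r M hq hr h).symm
  · let T := edgePathGroupEquivFundamentalGroup hX v
    let T' := edgePathGroupEquivFundamentalGroup (D.isConnected_right hX) p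
    -- The order of multiplication is reversed on both sides, so the reversals cancel.
    let Φ := T.symm.trans (Ψ.op.trans T')
    have hΦ : ∀ L : EdgePath (commonDivisorComplex X) v v,
        Φ L.toFundamentalGroup = T' (.op (Ψ (EdgePathGroup.mk L))) := fun L => by
      change T' (Ψ.op (T.symm (T (.op (EdgePathGroup.mk L))))) = _
      rw [T.symm_apply_apply]
      rfl
    have hΦ' : IsTopEtaStar (v := v) (p := p) Φ := fun L q r M hq hr h => by
      rw [hΦ, hΨ L q r M hq hr h]
      rfl
    refine ⟨Φ, hΦ', fun f hf => funext fun γ => ?_⟩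
    -- Every topological loop class comes from an edge-loop, on which the value of `f` is
    -- prescribed.
    obtain ⟨⟨⟨L⟩⟩, rfl⟩ := T.surjective γ
    obtain ⟨q, r, M, hq, hr, h⟩ := hex L
    exact (hf L q r M hq hr h).trans (hΦ' L q r M hq hr h).symm

end Main

end DivisorComplex

theorem mainTheorem1 :
    (∀ X : Set ℕ+, DivisorComplex.IsConnected (DivisorComplex.commonDivisorComplex X) →
      DivisorComplex.EtaStarIsIsomorphism X) ∧
    (∀ (G : Type*) [Group G] [Finite G],
      DivisorComplex.IsConnected
        (DivisorComplex.commonDivisorComplex (DivisorComplex.characterDegrees G)) →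
      DivisorComplex.EtaStarIsIsomorphism (DivisorComplex.characterDegrees G)) :=
  ⟨fun _ => DivisorComplex.etaStarIsIsomorphism, fun _ _ _ => DivisorComplex.etaStarIsIsomorphism⟩
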